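/- Let $\mathcal{A}$ be a unital complex Banach algebra with unit $1$. An element $a\in\mathcal{A}$ is called Drazin invertible if there is $b\in\mathcal{A}$ with $ab=ba$, $bab=b$ and $(a(1-ab))^n=0$ for some $n\in\mathbb{N}$; it is called g-Drazin invertible if there is $b\in\mathcal{A}$ with $ab=ba$, $bab=b$ and $a(1-ab)$ quasinilpotent, i.e. of spectral radius $0$. Theorem 2.5. Let $x_1,x_2,x_3\in\mathcal{A}$ and $\alpha_1,\alpha_2,\beta\in\mathbb{C}$ satisfy $$x_1+x_2+x_3=\alpha_1 1+\alpha_2(x_1x_2+x_1x_3+x_2x_3)\quad\text{and}\quad x_1x_2x_3=\beta(x_1x_2+x_1x_3+x_2x_3).$$ Then, if any three of the four elements $x_1,\ x_2,\ x_3,\ x_1x_2+x_1x_3+x_2x_3$ are Drazin invertible, so is the fourth; and if any three of these four elements are g-Drazin invertible, so is the fourth. -/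

import Mathlib

/-- `b` is a Drazin inverse of `a`. -/
def IsDrazinInverse {A : Type*} [Ring A] (a b : A) : Prop :=
  a * b = b * a ∧ b * a * b = b ∧ ∃ n : ℕ, (a * (1 - a * b)) ^ n = 0

/-- `a` is Drazin invertible: it has a Drazin inverse. -/
def IsDrazinInvertible {A : Type*} [Ring A] (a : A) : Prop :=
  ∃ b : A, IsDrazinInverse a b

/-- `a` is quasinilpotent: its spectral radius is `0`. -/
def IsQuasinilpotent {A : Type*} [NormedRing A] [NormedAlgebra ℂ A] (a : A) : Prop :=
  spectralRadius ℂ a = 0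

/-- `b` is a generalized Drazin (g-Drazin) inverse of `a`. -/
def IsGDrazinInverse {A : Type*} [NormedRing A] [NormedAlgebra ℂ A] (a b : A) : Prop :=
  a * b = b * a ∧ b * a * b = b ∧ IsQuasinilpotent (a * (1 - a * b))

/-- `a` is g-Drazin invertible: it has a g-Drazin inverse. -/
def IsGDrazinInvertible {A : Type*} [NormedRing A] [NormedAlgebra ℂ A] (a : A) : Prop :=
  ∃ b : A, IsGDrazinInverse a b

/-! Drazin invertibility is read off the resolvent near `0`: `a` is g-Drazin invertible iff `z - a`
is invertible for all small `z ≠ 0` (`isGDrazinInvertible_iff`), and Drazin invertible iff moreover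
`(z - a)⁻¹` is `O(|z|⁻ⁿ)` for some `n` (`isDrazinInvertible_iff`).

With `q = x₁x₂ + x₁x₃ + x₂x₃`, expanding and using the two hypotheses gives `(z - x₁)(z - x₂)(z -
x₃) = (α₂z² - z + β)(w - q)`, where `w = z²(z - α₁)/(α₂z² - z + β)`. No commutativity is needed. As
`z → 0` with `z ≠ 0`, so does `w`; conversely each `w ≠ 0` comes from some `z ≠ 0` that tends to `0`
with `w` (`exists_tendsto_root`). Since `w = O(z)` and `z³ = O(w)`, polynomial growth passes both
ways. Hence the product of the three pencils is invertible near `0`, with polar inverse, iff the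
pencil of `q` is. Invertible factors can be multiplied or cancelled, so any three elements control
the fourth. -/

open Filter Topology Asymptotics Metric

/-! ### Laurent coefficients of the resolvent at an isolated spectral point. -/

section ResolventMoment

variable {A : Type*} [NormedRing A] [NormedAlgebra ℂ A]

/-- The `k`-th moment of the resolvent of `a` over the circle of radius `r` around `0`, i.e. a
Laurent coefficient of the resolvent when `0` is an isolated point of the spectrum. -/
noncomputable def resolventMoment (a : A) (r : ℝ) (k : ℤ) : A :=
  (2 * Real.pi * Complex.I : ℂ)⁻¹ • ∮ z in C(0, r), z ^ k • resolvent a z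

theorem norm_resolventMoment_le {a : A} {r C : ℝ} (hr : 0 < r)
    (hC : ∀ z : ℂ, ‖z‖ = r → ‖resolvent a z‖ ≤ C) (k : ℤ) :
    ‖resolventMoment a r k‖ ≤ r * (r ^ k * C) := by
  refine circleIntegral.norm_two_pi_i_inv_smul_integral_le_of_norm_le_const hr.le fun z hz => ?_
  have hz' : ‖z‖ = r := by simpa using hz
  rw [norm_smul, norm_zpow, hz']
  gcongr
  exact hC z hz'

theorem mul_resolvent {a : A} {z : ℂ} (h : z ∈ resolventSet ℂ a) :
    a * resolvent a z = z • resolvent a z - 1 := by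
  have := Ring.mul_inverse_cancel _ h
  rw [sub_mul, ← Algebra.smul_def] at this
  rw [resolvent, ← this]; abel

theorem resolvent_mul {a : A} {z : ℂ} (h : z ∈ resolventSet ℂ a) :
    resolvent a z * a = z • resolvent a z - 1 := by
  have := Ring.inverse_mul_cancel _ h
  rw [mul_sub, ← Algebra.commutes, ← Algebra.smul_def] at this
  rw [resolvent, ← this]; abel

variable [CompleteSpace A]

theorem differentiableAt_zpow_smul_resolvent {a : A} {z : ℂ} (hz : z ≠ 0)
    (h : z ∈ resolventSet ℂ a) (k : ℤ) :
    DifferentiableAt ℂ (fun z => z ^ k • resolvent a z) z :=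
  (differentiableAt_zpow.2 (Or.inl hz)).smul (spectrum.hasDerivAt_resolvent_const_left h).differentiableAt

theorem resolventMoment_eq_of_le {a : A} {ε r s : ℝ}
    (ha : ∀ z : ℂ, z ≠ 0 → ‖z‖ < ε → z ∈ resolventSet ℂ a)
    (hr : 0 < r) (hrs : r ≤ s) (hs : s < ε) (k : ℤ) :
    resolventMoment a s k = resolventMoment a r k := by
  have key : ∀ z : ℂ, r ≤ ‖z‖ → ‖z‖ ≤ s →
      DifferentiableAt ℂ (fun z => z ^ k • resolvent a z) z := fun z h1 h2 =>
    have hz : z ≠ 0 := norm_pos_iff.1 (hr.trans_le h1)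
    differentiableAt_zpow_smul_resolvent hz (ha z hz (h2.trans_lt hs)) k
  unfold resolventMoment
  congr 1
  refine Complex.circleIntegral_eq_of_differentiable_on_annulus_off_countable hr hrs
    Set.countable_empty (fun z hz => ?_) fun z hz => ?_
  · simp only [Set.mem_sdiff, mem_closedBall, dist_zero_right, mem_ball, not_lt] at hz
    exact (key z hz.2 hz.1).continuousAt.continuousWithinAt
  · simp only [Set.mem_sdiff, mem_closedBall, dist_zero_right, mem_ball, not_le] at hz
    exact key z hz.1.2.le hz.1.1.le

theorem continuousOn_sphere_zpow_smul_resolvent {a : A} {r : ℝ} (hr : 0 < r)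
    (ha : ∀ z : ℂ, ‖z‖ = r → z ∈ resolventSet ℂ a) (k : ℤ) :
    ContinuousOn (fun z : ℂ => z ^ k • resolvent a z) (sphere 0 r) := fun z hz => by
  have hz' : ‖z‖ = r := by simpa using hz
  exact (differentiableAt_zpow_smul_resolvent (norm_pos_iff.1 (hz' ▸ hr))
    (ha z hz') k).continuousAt.continuousWithinAt

theorem circleIntegral_clm_comp {E F : Type*} [NormedAddCommGroup E] [NormedSpace ℂ E]
    [NormedAddCommGroup F] [NormedSpace ℂ F] [CompleteSpace E] [CompleteSpace F]
    (L : E →L[ℂ] F) {f : ℂ → E} {c : ℂ} {r : ℝ} (hf : CircleIntegrable f c r) :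
    ∮ z in C(c, r), L (f z) = L (∮ z in C(c, r), f z) := by
  simp only [circleIntegral]
  rw [← L.intervalIntegral_comp_comm hf.out]
  simp

theorem two_pi_I_inv_smul_circleIntegral_zpow {r : ℝ} (hr : 0 < r) (k : ℤ) :
    (2 * Real.pi * Complex.I : ℂ)⁻¹ • ∮ z in C(0, r), z ^ k • (1 : A) =
      if k = -1 then 1 else 0 := by
  rw [circleIntegral.integral_smul_const]
  split_ifs with hk
  · have := circleIntegral.integral_sub_center_inv (0 : ℂ) hr.ne'
    subst hk
    simp only [sub_zero] at this
    simp only [zpow_neg_one, this, smul_smul]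
    rw [inv_mul_cancel₀ Complex.two_pi_I_ne_zero, one_smul]
  · have := circleIntegral.integral_sub_zpow_of_ne hk (0 : ℂ) 0 r
    simp only [sub_zero] at this
    simp [this]

/-- Integrating `aR = zR - 1` shifts the index; the constant `1` contributes only through the
residue of `z⁻¹`. The map `L` stands for left or right multiplication by `a`. -/
theorem clm_resolventMoment {a : A} {r : ℝ} (hr : 0 < r)
    (ha : ∀ z : ℂ, ‖z‖ = r → z ∈ resolventSet ℂ a) (L : A →L[ℂ] A)
    (hL : ∀ z ∈ resolventSet ℂ a, L (resolvent a z) = z • resolvent a z - 1) (k : ℤ) :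
    L (resolventMoment a r k) = resolventMoment a r (k + 1) - if k = -1 then 1 else 0 := by
  have hint : ∀ k : ℤ, CircleIntegrable (fun z => z ^ k • resolvent a z) 0 r := fun k =>
    (continuousOn_sphere_zpow_smul_resolvent hr ha k).circleIntegrable hr.le
  have hint1 : CircleIntegrable (fun z : ℂ => z ^ k • (1 : A)) 0 r := by
    refine ContinuousOn.circleIntegrable hr.le fun z hz => ?_
    have hz' : ‖z‖ = r := by simpa using hz
    exact ((continuousAt_zpow₀ z k (Or.inl (norm_pos_iff.1 (hz' ▸ hr)))).smul
      continuousAt_const).continuousWithinAt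
  rw [← two_pi_I_inv_smul_circleIntegral_zpow (A := A) hr k]
  simp only [resolventMoment]
  rw [map_smul, ← smul_sub, ← circleIntegral.integral_sub (hint _) hint1,
    ← circleIntegral_clm_comp L (hint k)]
  congr 1
  refine circleIntegral.integral_congr hr.le fun z hz => ?_
  have hz' : ‖z‖ = r := by simpa using hz
  have hz0 : z ≠ 0 := norm_pos_iff.1 (hz' ▸ hr)
  simp only [map_smul, hL z (ha z hz'), smul_sub, smul_smul, zpow_add_one₀ hz0]

theorem mul_resolventMoment {a : A} {r : ℝ} (hr : 0 < r)
    (ha : ∀ z : ℂ, ‖z‖ = r → z ∈ resolventSet ℂ a) (k : ℤ) :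
    a * resolventMoment a r k = resolventMoment a r (k + 1) - if k = -1 then 1 else 0 :=
  clm_resolventMoment hr ha (ContinuousLinearMap.mul ℂ A a) (fun _ h => mul_resolvent h) k

theorem resolventMoment_mul {a : A} {r : ℝ} (hr : 0 < r)
    (ha : ∀ z : ℂ, ‖z‖ = r → z ∈ resolventSet ℂ a) (k : ℤ) :
    resolventMoment a r k * a = resolventMoment a r (k + 1) - if k = -1 then 1 else 0 :=
  clm_resolventMoment hr ha ((ContinuousLinearMap.mul ℂ A).flip a) (fun _ h => resolvent_mul h) k

theorem pow_mul_resolventMoment_zero {a : A} {r : ℝ} (hr : 0 < r)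
    (ha : ∀ z : ℂ, ‖z‖ = r → z ∈ resolventSet ℂ a) (n : ℕ) :
    a ^ n * resolventMoment a r 0 = resolventMoment a r n := by
  induction n with
  | zero => simp
  | succ n ih =>
    rw [pow_succ', mul_assoc, ih, mul_resolventMoment hr ha, if_neg (by lia)]
    simp

theorem pow_mul_resolventMoment_neg {a : A} {r : ℝ} (hr : 0 < r)
    (ha : ∀ z : ℂ, ‖z‖ = r → z ∈ resolventSet ℂ a) (n : ℕ) :
    a ^ n * resolventMoment a r (-1 - n) = resolventMoment a r (-1) := by
  induction n with
  | zero => simp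
  | succ n ih =>
    rw [pow_succ, mul_assoc, mul_resolventMoment hr ha, if_neg (by lia), sub_zero, ← ih]
    congr 2
    push_cast; ring

theorem exists_norm_resolvent_le_of_sphere {a : A} {r : ℝ} (hr : 0 < r)
    (ha : ∀ z : ℂ, ‖z‖ = r → z ∈ resolventSet ℂ a) :
    ∃ C, ∀ z : ℂ, ‖z‖ = r → ‖resolvent a z‖ ≤ C := by
  obtain ⟨C, hC⟩ := (isCompact_sphere (0 : ℂ) r).exists_bound_of_continuousOn
    (continuousOn_sphere_zpow_smul_resolvent hr ha 0)
  exact ⟨C, fun z hz => by simpa using hC z (by simpa using hz)⟩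

theorem commute_pow_resolventMoment {a : A} {r : ℝ} (hr : 0 < r)
    (ha : ∀ z : ℂ, ‖z‖ = r → z ∈ resolventSet ℂ a) (k : ℤ) (n : ℕ) :
    Commute (a ^ n) (resolventMoment a r k) := by
  refine Commute.pow_left ?_ n
  rw [commute_iff_eq, mul_resolventMoment hr ha, resolventMoment_mul hr ha]

/-- Moment `0` is the spectral projection at `0`, and minus moment `-1` inverts `a` on the
complement. Moving `aⁿ` from one factor to the other, with the first circle shrunk to radius `s /
2`, bounds the product by a constant times `2⁻ⁿ` for every `n`. -/
theorem resolventMoment_zero_mul_neg_one {a : A} {ε s : ℝ}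
    (ha : ∀ z : ℂ, z ≠ 0 → ‖z‖ < ε → z ∈ resolventSet ℂ a) (hs : 0 < s) (hsε : s < ε) :
    resolventMoment a s 0 * resolventMoment a s (-1) = 0 := by
  have hsph : ∀ r, 0 < r → r < ε → ∀ z : ℂ, ‖z‖ = r → z ∈ resolventSet ℂ a :=
    fun r h1 h2 z hz => ha z (norm_pos_iff.1 (hz ▸ h1)) (hz ▸ h2)
  have hr : 0 < s / 2 := by positivity
  have hrε : s / 2 < ε := by linarith
  obtain ⟨C, hC⟩ := exists_norm_resolvent_le_of_sphere hr (hsph _ hr hrε)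
  obtain ⟨D, hD⟩ := exists_norm_resolvent_le_of_sphere hs (hsph _ hs hsε)
  have hbd : ∀ n : ℕ, ‖resolventMoment a s 0 * resolventMoment a s (-1)‖ ≤
      (s / 2 * C * D) * (1 / 2 : ℝ) ^ n := by
    intro n
    have h1 : resolventMoment a s 0 * resolventMoment a s (-1) =
        resolventMoment a (s / 2) n * resolventMoment a s (-1 - n) := by
      rw [← resolventMoment_eq_of_le ha hr (by linarith) hsε n,
        ← pow_mul_resolventMoment_neg hs (hsph _ hs hsε) n,
        ← pow_mul_resolventMoment_zero hs (hsph _ hs hsε) n, ← mul_assoc,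
        (commute_pow_resolventMoment hs (hsph _ hs hsε) 0 n).eq]
    rw [h1]
    have hA := norm_resolventMoment_le hr hC n
    have hB := norm_resolventMoment_le hs hD (-1 - n)
    refine (norm_mul_le _ _).trans ((mul_le_mul hA hB (norm_nonneg _)
      ((norm_nonneg _).trans hA)).trans_eq ?_)
    rw [zpow_sub₀ hs.ne', zpow_neg_one, zpow_natCast, zpow_natCast, div_pow, div_pow, one_pow]
    field_simp
  have hlim : Tendsto (fun n : ℕ => (s / 2 * C * D) * (1 / 2 : ℝ) ^ n) atTop (𝓝 0) := by
    simpa using (tendsto_pow_atTop_nhds_zero_of_lt_one (by norm_num : (0 : ℝ) ≤ 1 / 2)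
      (by norm_num)).const_mul (s / 2 * C * D)
  exact norm_le_zero_iff.1 (ge_of_tendsto' hlim hbd)

/-- If `0` is at most an isolated point of the spectrum of `a`, then `a` has a commuting
generalized inverse `b` such that the powers of `a * (1 - a * b)` are moments of the resolvent. -/
theorem exists_partial_inverse_of_resolventSet {a : A} {ε : ℝ} (hε : 0 < ε)
    (ha : ∀ z : ℂ, z ≠ 0 → ‖z‖ < ε → z ∈ resolventSet ℂ a) :
    ∃ b : A, a * b = b * a ∧ b * a * b = b ∧
      ∀ r, 0 < r → r < ε → ∀ n : ℕ, (a * (1 - a * b)) ^ (n + 1) =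
        resolventMoment a r ((n + 1 : ℕ) : ℤ) := by
  obtain ⟨s, hs, hsε⟩ := exists_between hε
  have hsph : ∀ z : ℂ, ‖z‖ = s → z ∈ resolventSet ℂ a :=
    fun z hz => ha z (norm_pos_iff.1 (hz ▸ hs)) (hz ▸ hsε)
  have h1 : a * -resolventMoment a s (-1) = 1 - resolventMoment a s 0 := by
    rw [mul_neg, mul_resolventMoment hs hsph]; simp
  have h2 : -resolventMoment a s (-1) * a = 1 - resolventMoment a s 0 := by
    rw [neg_mul, resolventMoment_mul hs hsph]; simp
  have h3 := resolventMoment_zero_mul_neg_one ha hs hsε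
  have hcomm : Commute a (resolventMoment a s 0) := by
    simpa using commute_pow_resolventMoment hs hsph 0 1
  have hidem : IsIdempotentElem (resolventMoment a s 0) := by
    have : resolventMoment a s 0 * (1 - resolventMoment a s 0) = 0 := by
      rw [← h2, ← mul_assoc, mul_neg, h3, neg_zero, zero_mul]
    rw [mul_sub, mul_one, sub_eq_zero] at this
    exact this.symm
  -- With this `b`, `1 - a * b` is the idempotent moment `0`.
  refine ⟨-resolventMoment a s (-1), h1.trans h2.symm, ?_, fun r hr hrε n => ?_⟩
  · rw [h2, sub_mul, one_mul, mul_neg, h3, neg_zero, sub_zero]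
  · rw [h1, sub_sub_cancel, hcomm.mul_pow, hidem.pow_succ_eq,
      pow_mul_resolventMoment_zero hs hsph]
    rcases le_total r s with h | h
    · exact resolventMoment_eq_of_le ha hr h hsε _
    · exact (resolventMoment_eq_of_le ha hs h hrε _).symm

end ResolventMoment

/-! ### Drazin and g-Drazin invertibility in terms of the resolvent. -/

section Characterizations

variable {A : Type*} [NormedRing A] [NormedAlgebra ℂ A]

theorem isQuasinilpotent_iff {a : A} :
    IsQuasinilpotent a ↔ ∀ z : ℂ, z ≠ 0 → z ∈ resolventSet ℂ a := by
  constructor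
  · intro h z hz
    refine spectrum.mem_resolventSet_of_spectralRadius_lt ?_
    rw [IsQuasinilpotent] at h
    simpa [h] using hz
  · intro h
    refine le_antisymm (iSup₂_le fun z hz => ?_) zero_le
    have : z = 0 := by
      by_contra h0
      exact hz (h z h0)
    simp [this]

theorem exists_punctured_ball_of_eventually {P : ℂ → Prop} (h : ∀ᶠ z in 𝓝[≠] (0 : ℂ), P z) :
    ∃ ε > 0, ∀ z : ℂ, z ≠ 0 → ‖z‖ < ε → P z := by
  rw [eventually_nhdsWithin_iff, Metric.eventually_nhds_iff] at h
  obtain ⟨ε, hε, H⟩ := h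
  exact ⟨ε, hε, fun z h0 hz => H (by simpa using hz) h0⟩

/-- Block inversion along the idempotent `a * b`: on `1 - a * b`, `z - a` acts as `z - a(1 - ab)`;
on `a * b` it is inverted by `b(zb - 1)⁻¹`. -/
theorem sub_mul_eq_one_of_partial_inverse {a b r t : A} {z : ℂ} (hab : a * b = b * a)
    (hbab : b * a * b = b)
    (hr : (algebraMap ℂ A z - a * (1 - a * b)) * r = 1)
    (ht : (z • b - 1) * t = 1) :
    (algebraMap ℂ A z - a) * ((1 - a * b) * r + b * t) = 1 := by
  have hp : a * b * (a * b) = a * b := by rw [mul_assoc, ← mul_assoc b, hbab]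
  have e1 : (algebraMap ℂ A z - a) * (1 - a * b) =
      (1 - a * b) * (algebraMap ℂ A z - a * (1 - a * b)) := by
    have h1 := Algebra.commutes z (1 - a * b)
    have h2 : a * (1 - a * b) = (1 - a * b) * (a * (1 - a * b)) := by
      have : a * (a * b) = a * b * a := by rw [mul_assoc, hab]
      simp only [mul_sub, sub_mul, mul_one, one_mul]
      simp only [this]
      rw [← mul_assoc (a * b) (a * b) a, hp]
      abel
    rw [sub_mul, h1, mul_sub (1 - a * b), ← h2]
  have e2 : (algebraMap ℂ A z - a) * b = a * b * (z • b - 1) := by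
    have : a * b * b = b := by rw [hab, hbab]
    rw [sub_mul, ← Algebra.smul_def, mul_sub, mul_smul_comm, this, mul_one]
  rw [mul_add, ← mul_assoc, e1, ← mul_assoc, e2, mul_assoc, hr, mul_assoc, ht, mul_one, mul_one,
    sub_add_cancel]

theorem mul_sub_eq_one_of_partial_inverse {a b r t : A} {z : ℂ} (hab : a * b = b * a)
    (hbab : b * a * b = b)
    (hr : r * (algebraMap ℂ A z - a * (1 - a * b)) = 1)
    (ht : t * (z • b - 1) = 1) :
    (r * (1 - a * b) + t * b) * (algebraMap ℂ A z - a) = 1 := by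
  have hp : a * b * (a * b) = a * b := by rw [mul_assoc, ← mul_assoc b, hbab]
  have e1 : (1 - a * b) * (algebraMap ℂ A z - a) =
      (algebraMap ℂ A z - a * (1 - a * b)) * (1 - a * b) := by
    have h1 := Algebra.commutes z (1 - a * b)
    have h2 : (1 - a * b) * a = a * (1 - a * b) * (1 - a * b) := by
      have : a * (a * b) = a * b * a := by rw [mul_assoc, hab]
      simp only [mul_sub, sub_mul, mul_one, one_mul]
      rw [mul_assoc a (a * b) (a * b), hp, this]
      abel
    rw [mul_sub, ← h1, sub_mul _ _ (1 - a * b), ← h2]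
  have e2 : b * (algebraMap ℂ A z - a) = (z • b - 1) * (a * b) := by
    have : b * (a * b) = b := by rw [← mul_assoc, hbab]
    rw [mul_sub, ← Algebra.commutes, ← Algebra.smul_def, sub_mul, smul_mul_assoc, this, one_mul,
      hab]
  rw [add_mul, mul_assoc, e1, ← mul_assoc, hr, one_mul, mul_assoc, e2, ← mul_assoc, ht, one_mul]
  abel

theorem tendsto_smul_sub_one (b : A) : Tendsto (fun z : ℂ => z • b - 1) (𝓝 0) (𝓝 (-1)) := by
  have : Continuous fun z : ℂ => z • b - 1 := by fun_prop
  simpa using this.tendsto 0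

variable [CompleteSpace A]

theorem eventually_mem_resolventSet_of_partial_inverse {a b : A} (hab : a * b = b * a)
    (hbab : b * a * b = b)
    (h : ∀ z : ℂ, z ≠ 0 → z ∈ resolventSet ℂ (a * (1 - a * b))) :
    ∀ᶠ z in 𝓝[≠] (0 : ℂ), z ∈ resolventSet ℂ a ∧ resolvent a z =
      (1 - a * b) * resolvent (a * (1 - a * b)) z + b * Ring.inverse (z • b - 1) := by
  have hu : ∀ᶠ z in 𝓝[≠] (0 : ℂ), IsUnit (z • b - 1) :=
    ((tendsto_smul_sub_one b).eventually
      (Units.isOpen.mem_nhds (isUnit_one.neg))).filter_mono nhdsWithin_le_nhds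
  filter_upwards [hu, self_mem_nhdsWithin] with z hz hz0
  have h1 := sub_mul_eq_one_of_partial_inverse hab hbab
    (Ring.mul_inverse_cancel _ (h z hz0)) (Ring.mul_inverse_cancel _ hz)
  have h2 := mul_sub_eq_one_of_partial_inverse hab hbab
    (Ring.inverse_mul_cancel _ (h z hz0)) (Ring.inverse_mul_cancel _ hz)
  have h3 : z ∈ resolventSet ℂ a := spectrum.mem_resolventSet_of_left_right_inverse h1 h2
  refine ⟨h3, ?_⟩
  have h4 := Ring.inverse_mul_cancel _ h3
  exact left_inv_eq_right_inv h4 h1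

theorem isGDrazinInvertible_iff {a : A} :
    IsGDrazinInvertible a ↔ ∀ᶠ z in 𝓝[≠] (0 : ℂ), z ∈ resolventSet ℂ a := by
  constructor
  · rintro ⟨b, hab, hbab, hq⟩
    exact (eventually_mem_resolventSet_of_partial_inverse hab hbab
      (isQuasinilpotent_iff.1 hq)).mono fun _ h => h.1
  · intro h
    obtain ⟨ε, hε, ha⟩ := exists_punctured_ball_of_eventually h
    obtain ⟨b, hab, hbab, hpow⟩ := exists_partial_inverse_of_resolventSet hε ha
    refine ⟨b, hab, hbab, isQuasinilpotent_iff.2 fun k hk => ?_⟩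
    by_contra hks
    obtain ⟨r, hr, hrlt⟩ := exists_between (lt_min hε (norm_pos_iff.2 hk))
    obtain ⟨hrε, hrk⟩ := lt_min_iff.1 hrlt
    obtain ⟨C, hC⟩ := exists_norm_resolvent_le_of_sphere hr
      (fun z hz => ha z (norm_pos_iff.1 (hz ▸ hr)) (hz ▸ hrε))
    -- A spectral value `k ≠ 0` of `a(1 - ab)` would have powers bounded by moments over a circle of
    -- radius `r < ‖k‖`, which grow at most like `rⁿ`.
    have hbd : ∀ n : ℕ, (‖k‖ / r) ^ (n + 1) ≤ r * C * ‖(1 : A)‖ := by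
      intro n
      have h1 : k ^ (n + 1) ∈ spectrum ℂ ((a * (1 - a * b)) ^ (n + 1)) :=
        spectrum.pow_mem_pow _ _ hks
      have h2 := spectrum.norm_le_norm_mul_of_mem h1
      rw [norm_pow, hpow r hr hrε n] at h2
      have h3 := h2.trans (mul_le_mul_of_nonneg_right
        (norm_resolventMoment_le hr hC ((n + 1 : ℕ) : ℤ)) (norm_nonneg _))
      rw [zpow_natCast] at h3
      rw [div_pow, div_le_iff₀ (by positivity)]
      linarith
    have htop := (tendsto_pow_atTop_atTop_of_one_lt ((one_lt_div hr).2 hrk)).comp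
      (tendsto_add_atTop_nat 1)
    obtain ⟨n, hn⟩ := (htop.eventually_gt_atTop (r * C * ‖(1 : A)‖)).exists
    exact absurd (hbd n) (not_le.2 hn)

omit [CompleteSpace A] in
theorem mem_resolventSet_of_pow_eq_zero {a : A} {n : ℕ} (h : a ^ n = 0) {z : ℂ} (hz : z ≠ 0) :
    z ∈ resolventSet ℂ a ∧ resolvent a z =
      (z⁻¹) ^ n • ∑ i ∈ Finset.range n, (algebraMap ℂ A z) ^ i * a ^ (n - 1 - i) := by
  have hc : Commute (algebraMap ℂ A z) a := Algebra.commutes z a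
  have hs : ((z⁻¹) ^ n) • (algebraMap ℂ A z) ^ n = 1 := by
    rw [← map_pow, Algebra.smul_def, ← map_mul, ← mul_pow,
      inv_mul_cancel₀ hz, one_pow, map_one]
  have h1 : (algebraMap ℂ A z - a) *
      ((z⁻¹) ^ n • ∑ i ∈ Finset.range n, (algebraMap ℂ A z) ^ i * a ^ (n - 1 - i)) = 1 := by
    rw [mul_smul_comm, hc.mul_geom_sum₂, h, sub_zero, hs]
  have h2 : ((z⁻¹) ^ n • ∑ i ∈ Finset.range n, (algebraMap ℂ A z) ^ i * a ^ (n - 1 - i)) *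
      (algebraMap ℂ A z - a) = 1 := by
    rw [smul_mul_assoc, hc.geom_sum₂_mul, h, sub_zero, hs]
  have h3 : z ∈ resolventSet ℂ a := spectrum.mem_resolventSet_of_left_right_inverse h1 h2
  exact ⟨h3, left_inv_eq_right_inv (Ring.inverse_mul_cancel _ h3) h1⟩

theorem isBigO_inv_pow_of_le {m n : ℕ} (h : m ≤ n) :
    (fun z : ℂ => (z⁻¹) ^ m) =O[𝓝[≠] 0] fun z => (z⁻¹) ^ n := by
  obtain ⟨k, rfl⟩ := Nat.exists_eq_add_of_le h
  refine IsBigO.of_bound 1 ?_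
  have : ∀ᶠ z in 𝓝[≠] (0 : ℂ), ‖z‖ < 1 :=
    nhdsWithin_le_nhds ((continuous_norm.tendsto (0 : ℂ)).eventually_lt_const (by simp))
  filter_upwards [this, self_mem_nhdsWithin] with z hz hz0
  have h0 : 0 < ‖z‖ := norm_pos_iff.2 hz0
  rw [pow_add, norm_mul, one_mul, norm_pow (z⁻¹) k, norm_inv]
  exact le_mul_of_one_le_right (norm_nonneg _) (one_le_pow₀ ((one_le_inv₀ h0).2 hz.le))

theorem isDrazinInvertible_iff {a : A} :
    IsDrazinInvertible a ↔ (∀ᶠ z in 𝓝[≠] (0 : ℂ), z ∈ resolventSet ℂ a) ∧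
      ∃ n : ℕ, resolvent a =O[𝓝[≠] 0] fun z : ℂ => (z⁻¹) ^ n := by
  constructor
  · rintro ⟨b, hab, hbab, n, hn⟩
    have key := eventually_mem_resolventSet_of_partial_inverse hab hbab
      fun z hz => (mem_resolventSet_of_pow_eq_zero hn hz).1
    refine ⟨key.mono fun _ h => h.1, n, ?_⟩
    refine IsBigO.congr' ?_ (EventuallyEq.symm (key.mono fun _ h => h.2)) EventuallyEq.rfl
    refine IsBigO.add ?_ ?_
    · have hS : Continuous fun z : ℂ => (1 - a * b) * ∑ i ∈ Finset.range n,
          (algebraMap ℂ A z) ^ i * (a * (1 - a * b)) ^ (n - 1 - i) := by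
        have := algebraMapCLM ℂ A |>.continuous
        simp only [coe_algebraMapCLM] at this
        fun_prop
      have hb : (fun z : ℂ => (z⁻¹) ^ n • ((1 - a * b) * ∑ i ∈ Finset.range n,
          (algebraMap ℂ A z) ^ i * (a * (1 - a * b)) ^ (n - 1 - i))) =O[𝓝[≠] 0]
          fun z : ℂ => (z⁻¹) ^ n • (1 : ℂ) :=
        (isBigO_refl _ _).smul (((hS.tendsto 0).isBigO_one ℂ).mono nhdsWithin_le_nhds)
      simp only [smul_eq_mul, mul_one] at hb
      refine hb.congr' ?_ EventuallyEq.rfl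
      filter_upwards [self_mem_nhdsWithin] with z hz
      rw [(mem_resolventSet_of_pow_eq_zero hn hz).2, mul_smul_comm]
    · have h1 : Tendsto (fun z : ℂ => b * Ring.inverse (z • b - 1)) (𝓝 0)
          (𝓝 (b * Ring.inverse (-1))) :=
        (((NormedRing.inverse_continuousAt (-1 : Aˣ)).tendsto.comp
          (by simpa using tendsto_smul_sub_one b)).const_mul b).congr (fun _ => rfl) |>.trans
          (by simp)
      have h2 := (h1.isBigO_one ℂ).mono (nhdsWithin_le_nhds (s := {0}ᶜ))
      simpa using h2.trans (by simpa using isBigO_inv_pow_of_le (Nat.zero_le n))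
  · rintro ⟨h, N, hN⟩
    obtain ⟨C, hC⟩ := hN.bound
    obtain ⟨ε, hε, ha'⟩ := exists_punctured_ball_of_eventually (h.and hC)
    have ha : ∀ z : ℂ, z ≠ 0 → ‖z‖ < ε → z ∈ resolventSet ℂ a := fun z h1 h2 => (ha' z h1 h2).1
    obtain ⟨b, hab, hbab, hpow⟩ := exists_partial_inverse_of_resolventSet hε ha
    -- `hpow` covers only positive exponents, hence `N + 1` even if `N = 0`. The moment is then at
    -- most `r · r^(N+1) · C r^(-N) = C r²`, and `r → 0`.
    refine ⟨b, hab, hbab, N + 1, ?_⟩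
    have hbd : ∀ᶠ r : ℝ in 𝓝[>] 0, ‖(a * (1 - a * b)) ^ (N + 1)‖ ≤ r * (r * C) := by
      filter_upwards [Ioo_mem_nhdsGT hε] with r hr
      rw [hpow r hr.1 hr.2 N]
      refine (norm_resolventMoment_le hr.1 (C := C * (r⁻¹) ^ N) (fun z hz => ?_) _).trans_eq ?_
      · have := (ha' z (norm_pos_iff.1 (hz ▸ hr.1)) (hz ▸ hr.2)).2
        rwa [norm_pow, norm_inv, hz] at this
      · have := hr.1.ne'
        rw [zpow_natCast, pow_succ, inv_pow]
        field_simp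
    have hlim : Tendsto (fun r : ℝ => r * (r * C)) (𝓝[>] 0) (𝓝 0) := by
      have : Continuous fun r : ℝ => r * (r * C) := by fun_prop
      simpa using (this.tendsto 0).mono_left nhdsWithin_le_nhds
    exact norm_le_zero_iff.1 (ge_of_tendsto hlim hbd)

end Characterizations

/-! ### The scalar correspondence between `z` and `w`. -/

section CubicScalars

/-- The moduli of the roots multiply to `‖p.coeff 0‖`; take the smallest root. -/
theorem Polynomial.Monic.exists_isRoot_norm_pow_natDegree_le {p : Polynomial ℂ} (hp : p.Monic)
    (hd : p.natDegree ≠ 0) : ∃ z, p.IsRoot z ∧ ‖z‖ ^ p.natDegree ≤ ‖p.coeff 0‖ := by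
  have hs : p.Splits := IsAlgClosed.splits p
  have hcard : p.roots.card = p.natDegree := hs.natDegree_eq_card_roots.symm
  have hne : p.roots.toFinset.Nonempty := by
    rw [Multiset.toFinset_nonempty, ← Multiset.card_pos, hcard]
    exact Nat.pos_of_ne_zero hd
  obtain ⟨z, hz, hmin⟩ := p.roots.toFinset.exists_min_image (fun z => ‖z‖) hne
  rw [Multiset.mem_toFinset] at hz
  refine ⟨z, Polynomial.isRoot_of_mem_roots hz, ?_⟩
  have h1 : p.coeff 0 = (-1) ^ p.natDegree * p.roots.prod :=
    hs.coeff_zero_eq_prod_roots_of_monic hp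
  have h2 : ‖p.roots.prod‖ = (p.roots.map fun z => ‖z‖).prod :=
    (Multiset.prod_hom p.roots (normHom (α := ℂ))).symm
  rw [h1, norm_mul, norm_pow, norm_neg, norm_one, one_pow, one_mul, h2, ← hcard,
    ← Multiset.prod_replicate, ← Multiset.map_const']
  exact Multiset.prod_map_le_prod_map₀ _ _ (fun _ _ => norm_nonneg _)
    fun w hw => hmin w (Multiset.mem_toFinset.2 hw)

theorem exists_root_cubic_norm_pow_le (a b c : ℂ) :
    ∃ z : ℂ, z ^ 3 + a * z ^ 2 + b * z + c = 0 ∧ ‖z‖ ^ 3 ≤ ‖c‖ := by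
  obtain ⟨z, hz, h⟩ := (Cubic.monic_of_a_eq_one' (b := a) (c := b)
    (d := c)).exists_isRoot_norm_pow_natDegree_le
    (by rw [Cubic.natDegree_of_a_ne_zero' one_ne_zero]; norm_num)
  rw [Cubic.natDegree_of_a_ne_zero' one_ne_zero, Cubic.coeff_eq_d] at h
  exact ⟨z, by simpa [Cubic.toPoly, Polynomial.IsRoot] using hz, h⟩

theorem exists_root_quadratic_norm_pow_le (b c : ℂ) :
    ∃ z : ℂ, z ^ 2 + b * z + c = 0 ∧ ‖z‖ ^ 2 ≤ ‖c‖ := by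
  obtain ⟨z, hz, h⟩ := (Cubic.monic_of_b_eq_one' (c := b)
    (d := c)).exists_isRoot_norm_pow_natDegree_le
    (by rw [Cubic.natDegree_of_b_ne_zero' one_ne_zero]; norm_num)
  rw [Cubic.natDegree_of_b_ne_zero' one_ne_zero, Cubic.coeff_eq_d] at h
  exact ⟨z, by simpa [Cubic.toPoly, Polynomial.IsRoot] using hz, h⟩

theorem tendsto_punctured_of_norm_pow_le {f : ℂ → ℂ} {n : ℕ} {K : ℝ} (hn : n ≠ 0)
    (h0 : ∀ w, w ≠ 0 → f w ≠ 0) (hf : ∀ w, w ≠ 0 → ‖f w‖ ^ n ≤ K * ‖w‖) :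
    Tendsto f (𝓝[≠] 0) (𝓝[≠] 0) := by
  refine tendsto_nhdsWithin_iff.2 ⟨?_, eventually_mem_nhdsWithin.mono h0⟩
  have h1 : (fun w => f w ^ n) =O[𝓝[≠] 0] fun w : ℂ => w :=
    IsBigO.of_bound K (eventually_mem_nhdsWithin.mono fun w hw => by
      simpa only [norm_pow] using hf w hw)
  have h2 : Tendsto (fun w => f w ^ n) (𝓝[≠] 0) (𝓝 0) :=
    h1.trans_tendsto (tendsto_id.mono_left nhdsWithin_le_nhds)
  rw [tendsto_zero_iff_norm_tendsto_zero]
  have h3 : Tendsto (fun w => ‖f w‖ ^ n) (𝓝[≠] 0) (𝓝 0) := by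
    simpa only [norm_pow, norm_zero] using h2.norm
  have h4 := h3.rpow_const (p := (n : ℝ)⁻¹) (Or.inr (by positivity))
  rw [Real.zero_rpow (by positivity)] at h4
  exact h4.congr fun w => Real.pow_rpow_inv_natCast (norm_nonneg _) hn

theorem exists_tendsto_root (α₁ α₂ β : ℂ) :
    ∃ f : ℂ → ℂ, Tendsto f (𝓝[≠] 0) (𝓝[≠] 0) ∧
      ∀ w, w ≠ 0 → f w ^ 2 * (f w - α₁) = (α₂ * f w ^ 2 - f w + β) * w := by
  -- For `β = 0` the cubic has the useless root `0`, so a factor `z` is cancelled first. In both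
  -- cases the constant term is then a nonzero multiple of `w`, which makes the smallest root
  -- nonzero and small.
  by_cases hβ : β = 0
  · subst hβ
    choose f hf hle using fun w => exists_root_quadratic_norm_pow_le (-(α₁ + w * α₂)) w
    refine ⟨f, tendsto_punctured_of_norm_pow_le (n := 2) (K := 1) two_ne_zero
      (fun w hw h => hw ?_) fun w _ => by simpa using hle w, fun w _ => ?_⟩
    · simpa [h] using hf w
    · linear_combination f w * hf w
  · choose f hf hle using fun w => exists_root_cubic_norm_pow_le (-(α₁ + w * α₂)) w (-(β * w))
    refine ⟨f, tendsto_punctured_of_norm_pow_le (n := 3) (K := ‖β‖) three_ne_zero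
      (fun w hw h => ?_) fun w _ => by simpa using hle w, fun w _ => ?_⟩
    · have := hf w
      simp [h, hβ, hw] at this
    · linear_combination hf w

theorem isBigO_one_left_of_continuousAt {f : ℂ → ℂ} (hf : ContinuousAt f 0) (h0 : f 0 ≠ 0) :
    (fun _ => (1 : ℂ)) =O[𝓝 0] f := by
  have h := (hf.inv₀ h0).tendsto.isBigO_one ℂ
  have := h.inv_rev ((hf.eventually_ne h0).mono fun z hz h => absurd (inv_eq_zero.1 h) hz)
  simpa using this

theorem isBigO_id_left_of_continuousAt {f : ℂ → ℂ} (hf : ContinuousAt f 0) (h0 : f 0 ≠ 0) :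
    (fun z : ℂ => z) =O[𝓝 0] f :=
  ((tendsto_id (α := ℂ) (x := 𝓝 0)).isBigO_one ℂ).trans (isBigO_one_left_of_continuousAt hf h0)

theorem isBigO_id_sub_const (α : ℂ) : (fun z : ℂ => z) =O[𝓝 0] fun z => z - α := by
  by_cases hα : α = 0
  · simpa [hα] using isBigO_refl _ _
  · exact isBigO_id_left_of_continuousAt (by fun_prop) (by simpa using hα)

/-- The linear coefficient `-1` limits the vanishing at `0` to order one, whatever `α` and `β` are.
-/
theorem isBigO_id_quadratic (α β : ℂ) :
    (fun z : ℂ => z) =O[𝓝 0] fun z => α * z ^ 2 - z + β := by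
  by_cases hβ : β = 0
  · have h1 : (fun _ => (1 : ℂ)) =O[𝓝 0] fun z => α * z - 1 :=
      isBigO_one_left_of_continuousAt (by fun_prop) (by simp)
    have h2 := (isBigO_refl (fun z : ℂ => z) (𝓝 0)).mul h1
    refine (h2.congr_left fun z => mul_one z).congr_right fun z => ?_
    rw [hβ]; ring
  · exact isBigO_id_left_of_continuousAt (by fun_prop) (by simpa using hβ)

theorem eventually_quadratic_ne_zero (α β : ℂ) :
    ∀ᶠ z in 𝓝[≠] (0 : ℂ), α * z ^ 2 - z + β ≠ 0 := by
  filter_upwards [nhdsWithin_le_nhds (isBigO_id_quadratic α β).eq_zero_imp, self_mem_nhdsWithin]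
    with z h hz h0 using hz (h h0)

theorem isBigO_inv_quadratic (α β : ℂ) :
    (fun z : ℂ => (α * z ^ 2 - z + β)⁻¹) =O[𝓝[≠] 0] fun z => z⁻¹ :=
  ((isBigO_id_quadratic α β).mono nhdsWithin_le_nhds).inv_rev
    (eventually_mem_nhdsWithin.mono fun _ hz h => absurd h hz)

/-- The point `w` at which `(z - x₁)(z - x₂)(z - x₃)` is a multiple of `w - q`, when
`x₁ + x₂ + x₃ = α₁ + α₂ q` and `x₁ x₂ x₃ = β q`. -/
noncomputable def spectralParam (α₁ α₂ β z : ℂ) : ℂ :=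
  z ^ 2 * (z - α₁) * (α₂ * z ^ 2 - z + β)⁻¹

theorem isBigO_spectralParam (α₁ α₂ β : ℂ) :
    spectralParam α₁ α₂ β =O[𝓝[≠] 0] fun z => z := by
  have h1 : (fun z : ℂ => z - α₁) =O[𝓝[≠] 0] fun _ => (1 : ℂ) := by
    have : Continuous fun z : ℂ => z - α₁ := by fun_prop
    exact ((this.tendsto 0).isBigO_one ℂ).mono nhdsWithin_le_nhds
  refine (((isBigO_refl (fun z : ℂ => z ^ 2) _).mul h1).mul
    (isBigO_inv_quadratic α₂ β)).congr' EventuallyEq.rfl ?_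
  filter_upwards [self_mem_nhdsWithin] with z hz
  have : z ≠ 0 := hz
  field_simp

theorem isBigO_pow_three_spectralParam (α₁ α₂ β : ℂ) :
    (fun z => z ^ 3) =O[𝓝[≠] 0] spectralParam α₁ α₂ β := by
  have h1 : (fun z : ℂ => α₂ * z ^ 2 - z + β) =O[𝓝[≠] 0] fun _ => (1 : ℂ) := by
    have : Continuous fun z : ℂ => α₂ * z ^ 2 - z + β := by fun_prop
    exact ((this.tendsto 0).isBigO_one ℂ).mono nhdsWithin_le_nhds
  have h2 := h1.inv_rev ((eventually_quadratic_ne_zero α₂ β).mono fun z hz h => absurd h hz)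
  refine (((isBigO_refl (fun z : ℂ => z ^ 2) _).mul
    ((isBigO_id_sub_const α₁).mono nhdsWithin_le_nhds)).mul h2).congr_left fun z => ?_
  rw [inv_one, mul_one, pow_succ z 2]

theorem tendsto_spectralParam (α₁ α₂ β : ℂ) :
    Tendsto (spectralParam α₁ α₂ β) (𝓝[≠] 0) (𝓝[≠] 0) := by
  refine tendsto_nhdsWithin_iff.2 ⟨(isBigO_spectralParam α₁ α₂ β).trans_tendsto
    (tendsto_id.mono_left nhdsWithin_le_nhds), ?_⟩
  filter_upwards [(isBigO_pow_three_spectralParam α₁ α₂ β).eq_zero_imp, self_mem_nhdsWithin]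
    with z h hz h0 using hz (pow_eq_zero_iff three_ne_zero |>.1 (h h0))

end CubicScalars

/-! ### Invertibility and polar growth near `0`, and their transfer. -/

section PuncturedUnits

variable {A : Type*} [NormedRing A]

/-- `f` takes invertible values near `0`, except possibly at `0`. -/
def IsUnitNear (f : ℂ → A) : Prop := ∀ᶠ z in 𝓝[≠] (0 : ℂ), IsUnit (f z)

/-- The inverse of `f` grows at most like a power of `z⁻¹` near `0`. -/
def HasPolarInverse (f : ℂ → A) : Prop :=
  ∃ n : ℕ, (fun z => Ring.inverse (f z)) =O[𝓝[≠] 0] fun z : ℂ => (z⁻¹) ^ n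

theorem Ring.inverse_eq_of_mul_eq_one {M : Type*} [MonoidWithZero M] {a b : M} (h : IsUnit a)
    (hab : a * b = 1) : Ring.inverse a = b :=
  left_inv_eq_right_inv (Ring.inverse_mul_cancel a h) hab

theorem Ring.inverse_mul_of_isUnit {M : Type*} [MonoidWithZero M] {a b : M} (ha : IsUnit a)
    (hb : IsUnit b) : Ring.inverse (a * b) = Ring.inverse b * Ring.inverse a := by
  refine inverse_eq_of_mul_eq_one (ha.mul hb) ?_
  rw [mul_assoc, ← mul_assoc b, Ring.mul_inverse_cancel b hb, one_mul,
    Ring.mul_inverse_cancel a ha]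

namespace IsUnitNear

variable {f g : ℂ → A}

theorem mul (hf : IsUnitNear f) (hg : IsUnitNear g) : IsUnitNear (f * g) := by
  filter_upwards [hf, hg] with z h1 h2 using h1.mul h2

theorem of_mul_left (hf : IsUnitNear f) (h : IsUnitNear (f * g)) : IsUnitNear g := by
  filter_upwards [hf, h] with z h1 h2
  obtain ⟨u, hu⟩ := h1
  exact (Units.isUnit_units_mul u (g z)).1 (by simpa [hu] using h2)

theorem of_mul_right (hg : IsUnitNear g) (h : IsUnitNear (f * g)) : IsUnitNear f := by
  filter_upwards [hg, h] with z h1 h2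
  obtain ⟨u, hu⟩ := h1
  exact (Units.isUnit_mul_units (f z) u).1 (by simpa [hu] using h2)

end IsUnitNear

namespace HasPolarInverse

variable {f g : ℂ → A}

theorem mul (hf : IsUnitNear f) (hg : IsUnitNear g) (pf : HasPolarInverse f)
    (pg : HasPolarInverse g) : HasPolarInverse (f * g) := by
  obtain ⟨m, hm⟩ := pf
  obtain ⟨n, hn⟩ := pg
  refine ⟨n + m, ((hn.mul hm).congr' ?_ ?_)⟩
  · filter_upwards [hf, hg] with z h1 h2 using (Ring.inverse_mul_of_isUnit h1 h2).symm
  · exact .of_forall fun z => (pow_add _ _ _).symm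

/-- `g⁻¹ = (fg)⁻¹ f`, and `f` is bounded near `0`; no growth bound on `f⁻¹` is needed. -/
theorem of_mul_left (hf : IsUnitNear f) (h : IsUnitNear (f * g)) (cf : Continuous f)
    (p : HasPolarInverse (f * g)) : HasPolarInverse g := by
  obtain ⟨n, hn⟩ := p
  have h1 := ((cf.tendsto 0).isBigO_one ℂ).mono (nhdsWithin_le_nhds (s := {0}ᶜ))
  refine ⟨n, (hn.mul h1).congr' ?_ (.of_forall fun z => mul_one _)⟩
  filter_upwards [hf, hf.of_mul_left h] with z h2 h3
  rw [Pi.mul_apply, Ring.inverse_mul_of_isUnit h2 h3, mul_assoc, Ring.inverse_mul_cancel _ h2,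
    mul_one]

theorem of_mul_right (hg : IsUnitNear g) (h : IsUnitNear (f * g)) (cg : Continuous g)
    (p : HasPolarInverse (f * g)) : HasPolarInverse f := by
  obtain ⟨n, hn⟩ := p
  have h1 := ((cg.tendsto 0).isBigO_one ℂ).mono (nhdsWithin_le_nhds (s := {0}ᶜ))
  refine ⟨n, (h1.mul hn).congr' ?_ (.of_forall fun z => one_mul _)⟩
  filter_upwards [hg, hg.of_mul_right h] with z h2 h3
  rw [Pi.mul_apply, Ring.inverse_mul_of_isUnit h3 h2, ← mul_assoc, Ring.mul_inverse_cancel _ h2,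
    one_mul]

end HasPolarInverse

variable [NormedAlgebra ℂ A]

theorem Ring.inverse_smul_of_isUnit {k : ℂ} {x : A} (hk : k ≠ 0) (hx : IsUnit x) :
    IsUnit (k • x) ∧ Ring.inverse (k • x) = k⁻¹ • Ring.inverse x := by
  have h : IsUnit (k • x) := by
    rw [Algebra.smul_def]
    exact ((isUnit_iff_ne_zero.2 hk).map _).mul hx
  refine ⟨h, inverse_eq_of_mul_eq_one h ?_⟩
  rw [smul_mul_smul_comm, Ring.mul_inverse_cancel x hx, mul_inv_cancel₀ hk, one_smul]

/-- The pencil `z ↦ z - a`. -/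
noncomputable def linearPencil (a : A) (z : ℂ) : A := algebraMap ℂ A z - a

theorem continuous_linearPencil (a : A) : Continuous (linearPencil a) := by
  have := (algebraMapCLM ℂ A).continuous
  simp only [coe_algebraMapCLM] at this
  unfold linearPencil
  fun_prop

/-- Keeping the relation between `z` and `w` free of division lets it serve both with `w` computed
from `z` and with `z` a root for given `w`. -/
theorem linearPencil_mul_mul_eq {x₁ x₂ x₃ q : A} {α₁ α₂ β z w : ℂ}
    (hq : q = x₁ * x₂ + x₁ * x₃ + x₂ * x₃)
    (hsum : x₁ + x₂ + x₃ = α₁ • (1 : A) + α₂ • q) (hprod : x₁ * x₂ * x₃ = β • q)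
    (hw : z ^ 2 * (z - α₁) = (α₂ * z ^ 2 - z + β) * w) :
    (linearPencil x₁ * linearPencil x₂ * linearPencil x₃) z =
      (α₂ * z ^ 2 - z + β) • linearPencil q w := by
  have h1 : (linearPencil x₁ * linearPencil x₂ * linearPencil x₃) z =
      z ^ 3 • (1 : A) - z ^ 2 • (x₁ + x₂ + x₃) + z • q - x₁ * x₂ * x₃ := by
    simp only [Pi.mul_apply, linearPencil, Algebra.algebraMap_eq_smul_one, mul_sub, sub_mul,
      smul_mul_assoc, mul_smul_comm, one_mul, mul_one, hq]
    module
  rw [h1, hsum, hprod, linearPencil, Algebra.algebraMap_eq_smul_one, smul_sub, smul_smul, ← hw]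
  module

section Transfer

variable {q : A} {F : ℂ → A} {α₁ α₂ β : ℂ}

theorem eventually_eq_smul_linearPencil_spectralParam
    (hF : ∀ z w, z ^ 2 * (z - α₁) = (α₂ * z ^ 2 - z + β) * w →
      F z = (α₂ * z ^ 2 - z + β) • linearPencil q w) :
    ∀ᶠ z in 𝓝[≠] (0 : ℂ), F z =
      (α₂ * z ^ 2 - z + β) • linearPencil q (spectralParam α₁ α₂ β z) := by
  filter_upwards [eventually_quadratic_ne_zero α₂ β] with z hz
  refine hF z _ ?_
  rw [spectralParam, mul_left_comm, mul_inv_cancel₀ hz, mul_one]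

theorem isUnitNear_of_linearPencil
    (hF : ∀ z w, z ^ 2 * (z - α₁) = (α₂ * z ^ 2 - z + β) * w →
      F z = (α₂ * z ^ 2 - z + β) • linearPencil q w)
    (h : IsUnitNear (linearPencil q)) : IsUnitNear F := by
  filter_upwards [eventually_eq_smul_linearPencil_spectralParam hF,
    (tendsto_spectralParam α₁ α₂ β).eventually h, eventually_quadratic_ne_zero α₂ β]
    with z h1 h2 h3
  rw [h1]
  exact (Ring.inverse_smul_of_isUnit h3 h2).1

theorem hasPolarInverse_of_linearPencil
    (hF : ∀ z w, z ^ 2 * (z - α₁) = (α₂ * z ^ 2 - z + β) * w →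
      F z = (α₂ * z ^ 2 - z + β) • linearPencil q w)
    (h : IsUnitNear (linearPencil q)) (hp : HasPolarInverse (linearPencil q)) :
    HasPolarInverse F := by
  obtain ⟨n, hn⟩ := hp
  have h1 : (spectralParam α₁ α₂ β)⁻¹ =O[𝓝[≠] 0] (fun z : ℂ => z ^ 3)⁻¹ :=
    (isBigO_pow_three_spectralParam α₁ α₂ β).inv_rev
      (eventually_mem_nhdsWithin.mono fun z hz h0 =>
        absurd (pow_eq_zero_iff three_ne_zero |>.1 h0) hz)
  have h2 := (hn.comp_tendsto (tendsto_spectralParam α₁ α₂ β)).trans (h1.pow n)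
  -- One order comes from the inverse quadratic, `3 * n` from `w⁻¹ = O(z⁻³)`.
  refine ⟨1 + 3 * n, ((isBigO_inv_quadratic α₂ β).smul h2).congr' ?_ ?_⟩
  · filter_upwards [eventually_eq_smul_linearPencil_spectralParam hF,
      (tendsto_spectralParam α₁ α₂ β).eventually h, eventually_quadratic_ne_zero α₂ β]
      with z h1 h2 h3
    rw [h1, (Ring.inverse_smul_of_isUnit h3 h2).2]
    rfl
  · refine .of_forall fun z => ?_
    simp only [Pi.inv_apply, smul_eq_mul, pow_add, pow_mul, pow_one, inv_pow]

theorem eventually_linearPencil_of_root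
    (hF : ∀ z w, z ^ 2 * (z - α₁) = (α₂ * z ^ 2 - z + β) * w →
      F z = (α₂ * z ^ 2 - z + β) • linearPencil q w) (h : IsUnitNear F) {f : ℂ → ℂ}
    (hf : Tendsto f (𝓝[≠] 0) (𝓝[≠] 0))
    (hfw : ∀ w, w ≠ 0 → f w ^ 2 * (f w - α₁) = (α₂ * f w ^ 2 - f w + β) * w) :
    ∀ᶠ w in 𝓝[≠] (0 : ℂ), IsUnit (linearPencil q w) ∧ Ring.inverse (linearPencil q w) =
      (α₂ * f w ^ 2 - f w + β) • Ring.inverse (F (f w)) := by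
  filter_upwards [hf.eventually h, hf.eventually (eventually_quadratic_ne_zero α₂ β),
    self_mem_nhdsWithin] with w h1 h2 hw
  have h3 : linearPencil q w = (α₂ * f w ^ 2 - f w + β)⁻¹ • F (f w) := by
    rw [hF _ w (hfw w hw), smul_smul, inv_mul_cancel₀ h2, one_smul]
  have h4 := Ring.inverse_smul_of_isUnit (inv_ne_zero h2) h1
  rw [h3, h4.2, inv_inv]
  exact ⟨h4.1, rfl⟩

theorem linearPencil_isUnitNear_of
    (hF : ∀ z w, z ^ 2 * (z - α₁) = (α₂ * z ^ 2 - z + β) * w →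
      F z = (α₂ * z ^ 2 - z + β) • linearPencil q w) (h : IsUnitNear F) :
    IsUnitNear (linearPencil q) := by
  obtain ⟨f, hf, hfw⟩ := exists_tendsto_root α₁ α₂ β
  exact (eventually_linearPencil_of_root hF h hf hfw).mono fun _ h => h.1

theorem linearPencil_hasPolarInverse_of
    (hF : ∀ z w, z ^ 2 * (z - α₁) = (α₂ * z ^ 2 - z + β) * w →
      F z = (α₂ * z ^ 2 - z + β) • linearPencil q w) (h : IsUnitNear F)
    (hp : HasPolarInverse F) : HasPolarInverse (linearPencil q) := by
  obtain ⟨f, hf, hfw⟩ := exists_tendsto_root α₁ α₂ β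
  obtain ⟨n, hn⟩ := hp
  -- `w` is the spectral parameter of `f w`, so this is `w = O(z)` at `z = f w`.
  have h1 : (fun w : ℂ => w) =O[𝓝[≠] 0] f := by
    refine ((isBigO_spectralParam α₁ α₂ β).comp_tendsto hf).congr' ?_ EventuallyEq.rfl
    filter_upwards [hf.eventually (eventually_quadratic_ne_zero α₂ β), self_mem_nhdsWithin]
      with w h2 hw
    rw [Function.comp_apply, spectralParam, hfw w hw, mul_comm, ← mul_assoc, inv_mul_cancel₀ h2,
      one_mul]
  have h2 : f⁻¹ =O[𝓝[≠] 0] (fun w : ℂ => w)⁻¹ :=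
    h1.inv_rev (eventually_mem_nhdsWithin.mono fun w hw h0 => absurd h0 hw)
  have h3 : (fun w => α₂ * f w ^ 2 - f w + β) =O[𝓝[≠] 0] fun _ => (1 : ℂ) := by
    have : Continuous fun z : ℂ => α₂ * z ^ 2 - z + β := by fun_prop
    exact ((this.tendsto 0).comp (hf.mono_right nhdsWithin_le_nhds)).isBigO_one ℂ
  refine ⟨n, (h3.smul ((hn.comp_tendsto hf).trans (h2.pow n))).congr' ?_ ?_⟩
  · filter_upwards [eventually_linearPencil_of_root hF h hf hfw] with w hw using hw.2.symm
  · exact .of_forall fun w => one_smul ℂ _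

end Transfer

variable [CompleteSpace A]

theorem isGDrazinInvertible_iff_linearPencil {a : A} :
    IsGDrazinInvertible a ↔ IsUnitNear (linearPencil a) :=
  isGDrazinInvertible_iff

theorem isDrazinInvertible_iff_linearPencil {a : A} :
    IsDrazinInvertible a ↔ IsUnitNear (linearPencil a) ∧ HasPolarInverse (linearPencil a) :=
  isDrazinInvertible_iff

end PuncturedUnits
theorem theorem2p5 {A : Type*} [NormedRing A] [NormedAlgebra ℂ A] [CompleteSpace A]
    (x₁ x₂ x₃ : A) (α₁ α₂ β : ℂ)
    (hsum : x₁ + x₂ + x₃ = α₁ • (1 : A) + α₂ • (x₁ * x₂ + x₁ * x₃ + x₂ * x₃))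
    (hprod : x₁ * x₂ * x₃ = β • (x₁ * x₂ + x₁ * x₃ + x₂ * x₃)) :
    ((IsDrazinInvertible x₁ → IsDrazinInvertible x₂ → IsDrazinInvertible x₃ →
        IsDrazinInvertible (x₁ * x₂ + x₁ * x₃ + x₂ * x₃)) ∧
      (IsDrazinInvertible x₁ → IsDrazinInvertible x₂ →
        IsDrazinInvertible (x₁ * x₂ + x₁ * x₃ + x₂ * x₃) → IsDrazinInvertible x₃) ∧
      (IsDrazinInvertible x₁ → IsDrazinInvertible x₃ →
        IsDrazinInvertible (x₁ * x₂ + x₁ * x₃ + x₂ * x₃) → IsDrazinInvertible x₂) ∧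
      (IsDrazinInvertible x₂ → IsDrazinInvertible x₃ →
        IsDrazinInvertible (x₁ * x₂ + x₁ * x₃ + x₂ * x₃) → IsDrazinInvertible x₁)) ∧
    ((IsGDrazinInvertible x₁ → IsGDrazinInvertible x₂ → IsGDrazinInvertible x₃ →
        IsGDrazinInvertible (x₁ * x₂ + x₁ * x₃ + x₂ * x₃)) ∧
      (IsGDrazinInvertible x₁ → IsGDrazinInvertible x₂ →
        IsGDrazinInvertible (x₁ * x₂ + x₁ * x₃ + x₂ * x₃) → IsGDrazinInvertible x₃) ∧
      (IsGDrazinInvertible x₁ → IsGDrazinInvertible x₃ →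
        IsGDrazinInvertible (x₁ * x₂ + x₁ * x₃ + x₂ * x₃) → IsGDrazinInvertible x₂) ∧
      (IsGDrazinInvertible x₂ → IsGDrazinInvertible x₃ →
        IsGDrazinInvertible (x₁ * x₂ + x₁ * x₃ + x₂ * x₃) → IsGDrazinInvertible x₁)) := by
  have hF : ∀ z w, z ^ 2 * (z - α₁) = (α₂ * z ^ 2 - z + β) * w →
      (linearPencil x₁ * linearPencil x₂ * linearPencil x₃) z =
        (α₂ * z ^ 2 - z + β) • linearPencil (x₁ * x₂ + x₁ * x₃ + x₂ * x₃) w :=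
    fun z w => linearPencil_mul_mul_eq rfl hsum hprod
  have c₁ := continuous_linearPencil x₁
  have c₂ := continuous_linearPencil x₂
  have c₃ := continuous_linearPencil x₃
  simp only [isGDrazinInvertible_iff_linearPencil, isDrazinInvertible_iff_linearPencil]
  refine ⟨⟨?_, ?_, ?_, ?_⟩, ?_, ?_, ?_, ?_⟩
  · intro h₁ h₂ h₃
    have u := (h₁.1.mul h₂.1).mul h₃.1
    exact ⟨linearPencil_isUnitNear_of hF u, linearPencil_hasPolarInverse_of hF u
      (.mul (h₁.1.mul h₂.1) h₃.1 (.mul h₁.1 h₂.1 h₁.2 h₂.2) h₃.2)⟩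
  · intro h₁ h₂ h
    have u := isUnitNear_of_linearPencil hF h.1
    have v := h₁.1.mul h₂.1
    exact ⟨v.of_mul_left u,
      .of_mul_left v u (c₁.mul c₂) (hasPolarInverse_of_linearPencil hF h.1 h.2)⟩
  · intro h₁ h₃ h
    have u := isUnitNear_of_linearPencil hF h.1
    -- The middle factor is reached by cancelling `x₃`'s pencil on the right, then `x₁`'s on the
    -- left.
    have v := h₃.1.of_mul_right u
    exact ⟨h₁.1.of_mul_left v, .of_mul_left h₁.1 v c₁
      (.of_mul_right h₃.1 u c₃ (hasPolarInverse_of_linearPencil hF h.1 h.2))⟩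
  · intro h₂ h₃ h
    have u := isUnitNear_of_linearPencil hF h.1
    have v := h₃.1.of_mul_right u
    exact ⟨h₂.1.of_mul_right v, .of_mul_right h₂.1 v c₂
      (.of_mul_right h₃.1 u c₃ (hasPolarInverse_of_linearPencil hF h.1 h.2))⟩
  · exact fun h₁ h₂ h₃ => linearPencil_isUnitNear_of hF ((h₁.mul h₂).mul h₃)
  · exact fun h₁ h₂ h => (h₁.mul h₂).of_mul_left (isUnitNear_of_linearPencil hF h)
  · exact fun h₁ h₃ h => h₁.of_mul_left (h₃.of_mul_right (isUnitNear_of_linearPencil hF h))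
  · exact fun h₂ h₃ h => h₂.of_mul_right (h₃.of_mul_right (isUnitNear_of_linearPencil hF h))
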